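/- Let $(W,S)$ be a Coxeter system (with $S$ possibly infinite) with length function $\ell$ and set of reflections $T=\bigcup_{w\in W}wSw^{-1}$. Let $S=I\,\dot\cup\,J$ be a partition (one part may be empty) such that no element of $I$ is conjugate in $W$ to an element of $J$. For $K\subseteq S$ let $W_K$ be the subgroup of $W$ generated by $K$. Put $$\widetilde J=\{wsw^{-1}\mid w\in W_I,\ s\in J\},\qquad \widetilde W=\langle \widetilde J\rangle .$$ For $w\in W$ let $N(w)=\{t\in T\mid \ell(wt)<\ell(w)\}$, and let $\chi(\widetilde W)=\{t\in T\mid N(t)\cap\widetilde W=\{t\}\}$ be the set of canonical Coxeter generators of $\widetilde W$. For $a,b\in W$ let $m_{a,b}\in\{1,2,\dots\}\cup\{\infty\}$ be the order of $ab$. For $s\in S$ let $s^\perp=\{r\in S\mid rs=sr\}$. For $B,C\subseteq I$ let $X^I_{B,C}$ be the set of $x\in W_I$ that have minimal length in $W_BxW_C$. For $\tilde s,\tilde t\in\widetilde J$ let $s=\nu(\tilde s)$ and $t=\nu(\tilde t)$ be the unique elements of $J$ that are $W_I$-conjugate to $\tilde s$ and $\tilde t$ respectively, write $\tilde s=xsx^{-1}$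 and $\tilde t=yty^{-1}$ with $x,y\in W_I$, and let $f(\tilde s,\tilde t)$ be the unique element of $X^I_{I\cap s^\perp,\,I\cap t^\perp}$ such that $x^{-1}y\in W_{I\cap s^\perp}\,f(\tilde s,\tilde t)\,W_{I\cap t^\perp}$ (it does not depend on the choice of $x,y$). Define the matrix $\widetilde M=(\widetilde m_{\tilde s,\tilde t})_{\tilde s,\tilde t\in\widetilde J}$ by $$\widetilde m_{\tilde s,\tilde t}=\begin{cases}1&\text{if }\tilde s=\tilde t,\\ m_{s,u}/2&\text{if }s=t\text{ and }f(\tilde s,\tilde t)=u\in I,\\ \infty&\text{if }s=t\text{ and }\ell(f(\tilde s,\tilde t))\ge 2,\\ m_{s,t}&\text{if }s\ne t\text{ and }f(\tilde s,\tilde t)=1,\\ \infty&\text{if }s\neq t\text{ and }f(\tilde s,\tilde t)\ne 1,\end{cases}$$ where $\infty/2=\infty$. Then $(\widetilde W,\widetilde J)$ is a Coxeter system with Coxeter matrix $\widetilde M$ (in particular, the product $\tilde s\tilde t$ has order $\widetilde m_{\tilde s,\tilde t}$ for all $\tilde s,\tilde t\in\widetilde J$), and $\widetilde J=\chi(\widetilde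 W)$. -/

import Mathlib

namespace CoxeterSemidirect

/-- `J̃`: the set of conjugates `w s w⁻¹` with `w ∈ W_I` and `s ∈ J`, where `W_I` is the
subgroup generated by `I`. -/
def JTilde {W : Type*} [Group W] (I J : Set W) : Set W :=
  {r | ∃ s ∈ J, ∃ w ∈ Subgroup.closure I, r = w * s * w⁻¹}

/-- `W̃`: the subgroup generated by `J̃`. -/
def WTilde {W : Type*} [Group W] (I J : Set W) : Subgroup W :=
  Subgroup.closure (JTilde I J)

/-- `ν(r)`: the element of `J` that is conjugate to `r ∈ J̃` under `W_I`. -/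
noncomputable def nu {W : Type*} [Group W] {I J : Set W} (r : JTilde I J) : W :=
  Classical.choose r.2

theorem nu_spec {W : Type*} [Group W] {I J : Set W} (r : JTilde I J) :
    nu r ∈ J ∧ ∃ w ∈ Subgroup.closure I, (r : W) = w * nu r * w⁻¹ :=
  Classical.choose_spec r.2

section CoxeterSystem

variable {B W : Type*} [Group W] {M : CoxeterMatrix B} (cs : CoxeterSystem M W)

/-- `N(w)`: the set of reflections `t` with `ℓ(wt) < ℓ(w)`. -/
def inversionSet (w : W) : Set W :=
  {t | cs.IsReflection t ∧ cs.length (w * t) < cs.length w}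

/-- `χ(W')`: the set of reflections `t` with `N(t) ∩ W' = {t}`, the canonical Coxeter generators
of a subgroup `W'` generated by reflections. -/
def canonicalGenerators (W' : Subgroup W) : Set W :=
  {t | cs.IsReflection t ∧ inversionSet cs t ∩ (W' : Set W) = {t}}

/-- `s^⊥`: the set of simple reflections commuting with `s`. -/
def perp (s : W) : Set W :=
  {r | r ∈ Set.range cs.simple ∧ s * r = r * s}

/-- `X^A_{DE}`: the elements `x` of `W_A` that have minimal length in `W_D x W_E`. -/
def doubleCosetReps (A D E : Set W) : Set W :=
  {x | x ∈ Subgroup.closure A ∧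
    ∀ a ∈ Subgroup.closure D, ∀ b ∈ Subgroup.closure E, cs.length x ≤ cs.length (a * x * b)}

variable {I J : Set W}

/-- The condition characterising `f(r, r')` for `r, r' ∈ J̃`: writing `s = ν(r)` and `t = ν(r')`,
`g` lies in `X^I_{I ∩ s^⊥, I ∩ t^⊥}`, and `x⁻¹ y ∈ W_{I ∩ s^⊥} g W_{I ∩ t^⊥}` for some
`x, y ∈ W_I` with `r = x s x⁻¹` and `r' = y t y⁻¹`. -/
def IsDoubleCosetRep (r r' : JTilde I J) (g : W) : Prop :=
  g ∈ doubleCosetReps cs I (I ∩ perp cs (nu r)) (I ∩ perp cs (nu r')) ∧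
  ∃ x ∈ Subgroup.closure I, ∃ y ∈ Subgroup.closure I,
    (r : W) = x * nu r * x⁻¹ ∧ (r' : W) = y * nu r' * y⁻¹ ∧
    ∃ a ∈ Subgroup.closure (I ∩ perp cs (nu r)), ∃ b ∈ Subgroup.closure (I ∩ perp cs (nu r')),
      x⁻¹ * y = a * g * b

theorem exists_isDoubleCosetRep (r r' : JTilde I J) : ∃ g, IsDoubleCosetRep cs r r' g := by
  obtain ⟨-, x, hx, hrx⟩ := nu_spec r
  obtain ⟨-, y, hy, hry⟩ := nu_spec r'
  set P := Subgroup.closure (I ∩ perp cs (nu r)) with hP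
  set Q := Subgroup.closure (I ∩ perp cs (nu r')) with hQ
  have hPI : P ≤ Subgroup.closure I := Subgroup.closure_mono Set.inter_subset_left
  have hQI : Q ≤ Subgroup.closure I := Subgroup.closure_mono Set.inter_subset_left
  let C : Set W := {g | ∃ a ∈ P, ∃ b ∈ Q, g = a * (x⁻¹ * y) * b}
  have hC : C.Nonempty := ⟨x⁻¹ * y, 1, P.one_mem, 1, Q.one_mem, by simp⟩
  obtain ⟨g, ⟨a, ha, b, hb, hg⟩, hmin⟩ : ∃ g ∈ C, ∀ z ∈ C, cs.length g ≤ cs.length z :=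
    ⟨Function.argminOn cs.length C hC, Function.argminOn_mem _ _ _,
      fun z hz => Function.argminOn_le _ _ hz⟩
  refine ⟨g, ⟨?_, ?_⟩, x, hx, y, hy, hrx, hry, a⁻¹, P.inv_mem ha, b⁻¹, Q.inv_mem hb, ?_⟩
  · rw [hg]
    exact mul_mem (mul_mem (hPI ha) (mul_mem (inv_mem hx) hy)) (hQI hb)
  · intro c hc d hd
    exact hmin _ ⟨c * a, P.mul_mem hc ha, b * d, Q.mul_mem hb hd, by rw [hg]; group⟩
  · rw [hg]; group

/-- `f(r, r')`: the double coset representative attached to `r, r' ∈ J̃`. -/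
noncomputable def doubleCosetRep (r r' : JTilde I J) : W :=
  Classical.choose (exists_isDoubleCosetRep cs r r')

theorem doubleCosetRep_spec (r r' : JTilde I J) :
    IsDoubleCosetRep cs r r' (doubleCosetRep cs r r') :=
  Classical.choose_spec (exists_isDoubleCosetRep cs r r')

open Classical in
/-- The matrix `M̃` indexed by `J̃`. As for `orderOf` and `CoxeterMatrix`, the value `0` stands
for `∞`; in particular `∞ / 2 = ∞`.
With `s = ν(r)`, `t = ν(r')`, `g = f(r, r')` and `m` the order of a product, the entry is
`1` if `r = r'`; `m_{s,g} / 2` if `s = t` and `g ∈ I`; `∞` if `s = t` and `ℓ(g) ≥ 2`;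
`m_{s,t}` if `s ≠ t` and `g = 1`; `∞` if `s ≠ t` and `g ≠ 1`.
(When `r ≠ r'` and `s = t`, one has `g ≠ 1`, so that `g ∉ I` means `ℓ(g) ≥ 2`.) -/
noncomputable def mTilde (r r' : JTilde I J) : ℕ :=
  if r = r' then 1
  else if nu r = nu r' then
    if doubleCosetRep cs r r' ∈ I then orderOf (nu r * doubleCosetRep cs r r') / 2 else 0
  else
    if doubleCosetRep cs r r' = 1 then orderOf (nu r * nu r') else 0

end CoxeterSystem

end CoxeterSemidirect

/-! The group `W` is the semidirect product of `W_I` with the abstract Coxeter group `G` of `M̃`.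
Since no element of `I` is conjugate to one of `J`, every mixed order `m_{s,u}` is even or infinite.
Hence fixing `I` and killing `J` extends to a retraction of `W` onto `W_I` whose kernel contains
`W̃`, so `W_I ∩ W̃ = 1`.

Conjugation by `W_I` permutes `J̃` and preserves `M̃`, so it acts on `G`. The relations of `M̃` hold
in `W̃`, which gives a surjection `G → W̃` (`toWTilde`). The relations of `W` hold in `G ⋊ W_I`,
which gives `toSemidirect`; the relation `(s u)^{2k} = 1` becomes `(s · u s u)^k = 1` in `G`, whence
the entry `m_{s,u} / 2`. The composite `G → W̃ → G ⋊ W_I` is the inclusion of `G`, so `G → W̃` is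
injective. Nonzero entries of `M̃` are orders by direct computation; for the entry `0`, the
geometric representation of `G` shows that the order is infinite.

The equality `J̃ = χ(W̃)` comes from strong exchange (`mem_rightInvSeq_of_length_lt`), applied to
the word of `w s w⁻¹` and read modulo `W_I ∩ W̃ = 1`. -/

namespace CoxeterSemidirect

/-! ### Geometric representation: parabolic subgroups and infinite orders. -/

section GeometricRepresentation

open Polynomial.Chebyshev Real

/-- Powers of a product of two reflections have coefficients in the Chebyshev polynomials `S`,
evaluated at `2 cos θ` with `θ = 2π/m`. There `S_n` equals `sin((n+1)θ)/sin θ`, and the coefficients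
vanish because `mθ = 2π`. -/
theorem reflection_mul_reflection_pow_eq_one {V : Type*} [AddCommGroup V] [Module ℝ V]
    {x y : V} {f g : Module.Dual ℝ V} (hf : f x = 2) (hg : g y = 2) {m : ℕ} (hm : 2 ≤ m)
    (hfy : f y = -2 * cos (π / m)) (hgx : g x = -2 * cos (π / m)) :
    (Module.reflection hf * Module.reflection hg) ^ m = 1 := by
  ext z
  rcases hm.eq_or_lt with rfl | hm
  -- For `m = 2` one has `sin θ = 0`, so the quotient formula is unavailable; here the two
  -- reflections commute.
  · have h1 : f y = 0 := by rw [hfy]; simp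
    have h2 : g x = 0 := by rw [hgx]; simp
    simp [pow_two, Module.reflection_apply, h1, h2, hf, hg]
    module
  set θ : ℝ := 2 * π / m with hθ
  have hm0 : (0 : ℝ) < m := by positivity
  have hmθ : m * θ = 2 * π := by rw [hθ]; field_simp
  have ht : f y * g x - 2 = 2 * cos θ := by
    rw [hfy, hgx, hθ, show 2 * π / (m : ℝ) = 2 * (π / m) by ring, cos_two_mul]; ring
  have hsin : sin θ ≠ 0 := by
    refine (sin_pos_of_pos_of_lt_pi (by positivity) ?_).ne'
    rw [hθ, div_lt_iff₀ hm0]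
    have : (2 : ℝ) < m := by exact_mod_cast hm
    nlinarith [pi_pos]
  have hS (n : ℤ) : (S ℝ n).eval (2 * cos θ) = sin ((n + 1) * θ) / sin θ := by
    rw [eq_div_iff hsin, S_two_mul_real_cos]
  rw [Module.reflection_mul_reflection_pow_apply hf hg m z _ ht.symm]
  rcases Nat.even_or_odd' m with ⟨k, rfl | rfl⟩
  · have e1 : ((2 * k : ℕ) - 2 : ℤ) / 2 = k - 1 := by omega
    have e2 : ((2 * k : ℕ) - 1 : ℤ) / 2 = k - 1 := by omega
    have hk : (S ℝ (k - 1 : ℤ)).eval (2 * cos θ) = 0 := by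
      rw [hS]
      have : (((k - 1 : ℤ) : ℝ) + 1) * θ = π := by
        push_cast at hmθ ⊢; linarith
      rw [this, sin_pi, zero_div]
    rw [e1, e2, hk]; simp
  -- For odd `m` the angles `(k+1)θ` and `kθ` add up to `2π`, so their sines cancel.
  · have e1 : ((2 * k + 1 : ℕ) - 2 : ℤ) / 2 = k - 1 := by omega
    have e2 : ((2 * k + 1 : ℕ) - 1 : ℤ) / 2 = k := by omega
    have e3 : ((2 * k + 1 : ℕ) - 3 : ℤ) / 2 = k - 1 := by omega
    have e4 : ((2 * k + 1 : ℕ) : ℤ) / 2 = k := by omega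
    have hk : (S ℝ (k : ℤ)).eval (2 * cos θ) + (S ℝ (k - 1 : ℤ)).eval (2 * cos θ) = 0 := by
      rw [hS, hS, ← add_div]
      have : (((k : ℤ) : ℝ) + 1) * θ = 2 * π - (((k - 1 : ℤ) : ℝ) + 1) * θ := by
        push_cast at hmθ ⊢; linarith
      rw [this, sin_two_pi_sub, neg_add_cancel, zero_div]
    rw [e1, e2, e3, e4, hk]; simp

variable {B W : Type*} [Group W] {M : CoxeterMatrix B} (cs : CoxeterSystem M W)

/-- The linear form `v ↦ 2 ⟨αᵢ, v⟩` on the space with basis `(αᵢ)`, for the bilinear form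
`⟨αᵢ, αⱼ⟩ = -cos (π / M i j)`. The junk value `π / 0 = 0` gives `⟨αᵢ, αⱼ⟩ = -1` at `∞`. -/
noncomputable def simpleCoroot (M : CoxeterMatrix B) (i : B) : Module.Dual ℝ (B →₀ ℝ) :=
  Finsupp.linearCombination ℝ fun j => -2 * cos (π / M i j)

theorem simpleCoroot_single (i j : B) (c : ℝ) :
    simpleCoroot M i (Finsupp.single j c) = c * (-2 * cos (π / M i j)) := by
  simp [simpleCoroot]

theorem simpleCoroot_self (i : B) : simpleCoroot M i (Finsupp.single i 1) = 2 := by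
  simp [simpleCoroot_single]

theorem isLiftable_reflection (M : CoxeterMatrix B) :
    M.IsLiftable fun i => Module.reflection (simpleCoroot_self (M := M) i) := by
  intro i j
  rcases eq_or_ne i j with rfl | hij
  · rw [M.diagonal, pow_one, mul_eq_one_iff_eq_inv, Module.reflection_inv]
  · have h1 := M.off_diagonal i j hij
    rcases Nat.eq_zero_or_pos (M i j) with h0 | h0
    · rw [h0, pow_zero]
    · refine reflection_mul_reflection_pow_eq_one _ _ (by omega) ?_ ?_
      · rw [simpleCoroot_single, one_mul]
      · rw [simpleCoroot_single, one_mul, M.symmetric]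

/-- The geometric representation. -/
noncomputable def geometricRep : W →* ((B →₀ ℝ) ≃ₗ[ℝ] (B →₀ ℝ)) :=
  cs.lift ⟨_, isLiftable_reflection M⟩

theorem geometricRep_simple (i : B) (v : B →₀ ℝ) :
    geometricRep cs (cs.simple i) v = v - simpleCoroot M i v • Finsupp.single i 1 := by
  rw [geometricRep, CoxeterSystem.lift_apply_simple, Module.reflection_apply]

theorem geometricRep_sub_mem_of_mem_closure {K : Set B} {w : W}
    (hw : w ∈ Subgroup.closure (cs.simple '' K)) (v : B →₀ ℝ) :
    geometricRep cs w v - v ∈ Finsupp.supported ℝ ℝ K := by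
  induction hw using Subgroup.closure_induction generalizing v with
  | mem w hw =>
    obtain ⟨i, hi, rfl⟩ := hw
    rw [geometricRep_simple, sub_sub_cancel_left]
    exact neg_mem (Submodule.smul_mem _ _ (Finsupp.single_mem_supported ℝ 1 hi))
  | one => simp
  | mul x y _ _ hx hy =>
    have := add_mem (hx (geometricRep cs y v)) (hy v)
    rwa [sub_add_sub_cancel, ← LinearEquiv.mul_apply, ← map_mul] at this
  | inv x _ hx =>
    have := neg_mem (hx (geometricRep cs x⁻¹ v))
    rwa [neg_sub, ← LinearEquiv.mul_apply, ← map_mul, mul_inv_cancel, map_one] at this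

/-- Elements of `W_K` move vectors only by combinations of the `α_k` with `k ∈ K`, whereas `s_i`
moves `α_i` by `-2α_i`. -/
theorem mem_of_simple_mem_closure {K : Set B} {i : B}
    (h : cs.simple i ∈ Subgroup.closure (cs.simple '' K)) : i ∈ K := by
  have := geometricRep_sub_mem_of_mem_closure cs h (Finsupp.single i 1)
  rw [geometricRep_simple, sub_sub_cancel_left, simpleCoroot_self, neg_mem_iff,
    Finsupp.smul_single, Finsupp.mem_supported] at this
  exact this (by simp)

theorem simple_mem_of_mem_closure {K : Set W} (hK : K ⊆ Set.range cs.simple) {i : B}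
    (h : cs.simple i ∈ Subgroup.closure K) : cs.simple i ∈ K := by
  rw [← Set.image_preimage_eq_of_subset hK] at h
  exact mem_of_simple_mem_closure cs h

/-- The orbit of `α_i` under `s_i s_j` grows linearly, because the pairing of `α_i` and `α_j` is
`-1`. -/
theorem orderOf_simple_mul_simple_eq_zero {i j : B} (h : M i j = 0) :
    orderOf (cs.simple i * cs.simple j) = 0 := by
  have hij : i ≠ j := by rintro rfl; simp at h
  have hji : M j i = 0 := by rw [M.symmetric, h]
  have key (n : ℕ) : geometricRep cs ((cs.simple i * cs.simple j) ^ n) (Finsupp.single i 1) =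
      Finsupp.single i (2 * n + 1 : ℝ) + Finsupp.single j (2 * n : ℝ) := by
    induction n with
    | zero => simp
    | succ n ih =>
      rw [pow_succ', map_mul, LinearEquiv.mul_apply, ih, map_mul, LinearEquiv.mul_apply,
        geometricRep_simple, geometricRep_simple]
      simp only [map_add, map_sub, simpleCoroot_single, h, hji, M.diagonal,
        Finsupp.smul_single, smul_eq_mul]
      classical
      ext k
      simp only [Finsupp.coe_add, Finsupp.coe_sub, Pi.add_apply, Pi.sub_apply,
        Finsupp.single_apply, Nat.cast_zero, Nat.cast_one, div_zero, div_one, cos_zero, cos_pi]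
      push_cast
      split_ifs <;> ring
  rw [orderOf_eq_zero_iff']
  intro n hn hpow
  have := key n
  rw [hpow, map_one] at this
  have := DFunLike.congr_fun this j
  simp [hij, hn.ne'] at this

end GeometricRepresentation

/-! ### The reflection cocycle and strong exchange. -/

section ReflectionCocycle

variable {B W : Type*} [Group W] {M : CoxeterMatrix B} (cs : CoxeterSystem M W)

open Classical in
/-- The involution of `W × ℤ/2` attached to an involution `s`. -/
noncomputable def signedConj (s : W) (hs : s * s = 1) : Equiv.Perm (W × ZMod 2) :=
  Function.Involutive.toPerm
    (fun p => (s * p.1 * s, p.2 + if p.1 = s then 1 else 0)) (by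
      rintro ⟨t, e⟩
      have h1 : s * (s * t * s) * s = t := by
        rw [show s * (s * t * s) * s = (s * s) * t * (s * s) by group, hs]; simp
      have h2 : s * t * s = s ↔ t = s := by
        constructor
        · intro h; rw [h] at h1; rw [← h1, mul_assoc, hs, mul_one]
        · rintro rfl; rw [hs, one_mul]
      simp only [h1, h2, add_assoc, CharTwo.add_self_eq_zero, add_zero])

open Classical in
theorem signedConj_apply (s : W) (hs : s * s = 1) (p : W × ZMod 2) :
    signedConj s hs p = (s * p.1 * s, p.2 + if p.1 = s then 1 else 0) := rfl

theorem mul_pow_mul_mul_pow {a b : W} (ha : a * a = 1) (hb : b * b = 1) (n : ℕ) :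
    (a * b) ^ n * b * (a * b) ^ n = b := by
  induction n with
  | zero => simp
  | succ n ih =>
    calc (a * b) ^ (n + 1) * b * (a * b) ^ (n + 1)
        = (a * b) ^ n * (a * (b * b) * a * b) * (a * b) ^ n := by
          nth_rw 1 [pow_succ]; rw [pow_succ']; simp only [mul_assoc]
      _ = b := by rw [hb, mul_one, ha, one_mul, ih]

-- Each factor `a b` tests two conditions on the first coordinate. Since `b` inverts `a b`, after
-- `n` factors they read `(ab)^k p.1 = b` for `k = 2n` and `k = 2n + 1`.
open Classical in
theorem signedConj_mul_signedConj_pow (a b : W) (ha : a * a = 1) (hb : b * b = 1) (n : ℕ)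
    (p : W × ZMod 2) :
    ((signedConj a ha * signedConj b hb) ^ n) p =
      ((a * b) ^ n * p.1 * ((a * b) ^ n)⁻¹,
        p.2 + ∑ k ∈ Finset.range (2 * n), if (a * b) ^ k * p.1 = b then 1 else 0) := by
  have hai : a⁻¹ = a := inv_eq_of_mul_eq_one_left ha
  have hbi : b⁻¹ = b := inv_eq_of_mul_eq_one_left hb
  induction n with
  | zero => simp
  | succ n ih =>
    rw [pow_succ', Equiv.Perm.mul_apply, ih, Equiv.Perm.mul_apply, signedConj_apply,
      signedConj_apply]
    have key := mul_pow_mul_mul_pow ha hb n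
    have e1 : (a * b) ^ n * p.1 * ((a * b) ^ n)⁻¹ = b ↔ (a * b) ^ (2 * n) * p.1 = b := by
      rw [mul_inv_eq_iff_eq_mul, two_mul, pow_add, mul_assoc, ← mul_right_inj ((a * b) ^ n),
        ← mul_assoc _ b, key]
    have e2 : b * ((a * b) ^ n * p.1 * ((a * b) ^ n)⁻¹) * b = a ↔
        (a * b) ^ (2 * n + 1) * p.1 = b := by
      have h1 : (a * b) ^ n * (a * b) * (b * a * b * (a * b) ^ n) = b := by
        calc _ = (a * b) ^ n * (a * (b * b) * a * b) * (a * b) ^ n := by group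
          _ = b := by rw [hb, mul_one, ha, one_mul, key]
      rw [← eq_mul_inv_iff_mul_eq, ← eq_inv_mul_iff_mul_eq, hbi, mul_inv_eq_iff_eq_mul,
        show 2 * n + 1 = n + 1 + n by ring, pow_add, pow_succ, mul_assoc _ _ p.1,
        ← mul_right_inj ((a * b) ^ n * (a * b)), ← mul_assoc b a b, h1]
    simp only [e1, e2, show 2 * (n + 1) = 2 * n + 1 + 1 by ring, Finset.sum_range_succ]
    refine Prod.ext ?_ ?_
    · simp only [pow_succ' (a * b), mul_inv_rev, hai, hbi, mul_assoc]
    · simp only [add_assoc]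

/-- The sign sum runs over `2m` consecutive powers of an element whose `m`-th power is `1`, so every
term occurs twice and the sum vanishes in `ℤ/2`. -/
theorem isLiftable_signedConj :
    M.IsLiftable fun i => signedConj (cs.simple i) (cs.simple_mul_simple_self i) := by
  classical
  intro i j
  have hp := cs.simple_mul_simple_pow i j
  refine Equiv.ext fun p => ?_
  rw [signedConj_mul_signedConj_pow, two_mul, Finset.sum_range_add]
  have h : ∀ k, (cs.simple i * cs.simple j) ^ (M i j + k) = (cs.simple i * cs.simple j) ^ k :=
    fun k => by rw [pow_add, hp, one_mul]
  have h2 := Finset.sum_congr (s₁ := Finset.range (M i j)) rfl fun k _ =>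
    congrArg (fun x : W => if x * p.1 = cs.simple j then (1 : ZMod 2) else 0) (h k)
  refine Prod.ext (by simp [hp]) ?_
  simp only [h2, CharTwo.add_self_eq_zero, add_zero, Equiv.Perm.coe_one, id_eq]

/-- The permutation representation of `W` on `W × ℤ/2`. -/
noncomputable def signedConjRep : W →* Equiv.Perm (W × ZMod 2) :=
  cs.lift ⟨_, isLiftable_signedConj cs⟩

/-- The reflection cocycle: `reflectionCocycle cs w t = 1` means that `t` occurs an odd number of
times in the right inversion sequence of a word for `w`. -/
noncomputable def reflectionCocycle (w t : W) : ZMod 2 :=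
  (signedConjRep cs w (t, 0)).2

open Classical in
theorem signedConjRep_simple (i : B) (p : W × ZMod 2) : signedConjRep cs (cs.simple i) p =
    (cs.simple i * p.1 * cs.simple i, p.2 + if p.1 = cs.simple i then 1 else 0) := by
  rw [signedConjRep, CoxeterSystem.lift_apply_simple, signedConj_apply]

theorem signedConjRep_apply (w t : W) (e : ZMod 2) :
    signedConjRep cs w (t, e) = (w * t * w⁻¹, e + reflectionCocycle cs w t) := by
  classical
  induction w using cs.simple_induction_left generalizing t e with
  | one => simp [reflectionCocycle]
  | mul_simple_left w i ih =>
    rw [reflectionCocycle, map_mul, Equiv.Perm.mul_apply, Equiv.Perm.mul_apply, ih, ih,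
      signedConjRep_simple, signedConjRep_simple]
    simp only [mul_inv_rev, CoxeterSystem.inv_simple, mul_assoc, add_assoc, zero_add]

theorem reflectionCocycle_mul (w v t : W) : reflectionCocycle cs (w * v) t =
    reflectionCocycle cs v t + reflectionCocycle cs w (v * t * v⁻¹) := by
  rw [reflectionCocycle, map_mul, Equiv.Perm.mul_apply, signedConjRep_apply,
    signedConjRep_apply, zero_add]

theorem reflectionCocycle_one (t : W) : reflectionCocycle cs 1 t = 0 := by
  simp [reflectionCocycle]

open Classical in
theorem reflectionCocycle_simple (i : B) (t : W) :
    reflectionCocycle cs (cs.simple i) t = if t = cs.simple i then 1 else 0 := by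
  rw [reflectionCocycle, signedConjRep_simple, zero_add]

/-- For `t = v s v⁻¹` the contributions of `v` and `v⁻¹` cancel by the cocycle identity for `v v⁻¹ =
1`; only the `1` from `s` survives. -/
theorem reflectionCocycle_self {t : W} (ht : cs.IsReflection t) :
    reflectionCocycle cs t t = 1 := by
  obtain ⟨v, i, rfl⟩ := ht
  have h := reflectionCocycle_mul cs v v⁻¹ (v * cs.simple i * v⁻¹)
  have e : v⁻¹ * (v * cs.simple i * v⁻¹) * v⁻¹⁻¹ = cs.simple i := by group
  rw [mul_inv_cancel, reflectionCocycle_one, e] at h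
  rw [reflectionCocycle_mul, e, reflectionCocycle_mul, reflectionCocycle_simple, if_pos rfl,
    CoxeterSystem.inv_simple, CoxeterSystem.simple_mul_simple_self, one_mul, add_left_comm, ← h,
    add_zero]

theorem mem_rightInvSeq_of_reflectionCocycle_ne_zero {ω : List B} {t : W}
    (h : reflectionCocycle cs (cs.wordProd ω) t ≠ 0) : t ∈ cs.rightInvSeq ω := by
  classical
  induction ω with
  | nil => simp [reflectionCocycle_one] at h
  | cons i ω ih =>
    rw [CoxeterSystem.rightInvSeq, List.mem_cons]
    rw [cs.wordProd_cons, reflectionCocycle_mul, reflectionCocycle_simple] at h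
    by_cases h1 : cs.wordProd ω * t * (cs.wordProd ω)⁻¹ = cs.simple i
    · left
      rw [← h1]; group
    · rw [if_neg h1, add_zero] at h
      exact .inr (ih h)

/-- If the value at `w` were `0`, it would be `1` at `w t`. Then `t` would be a right inversion of
`w t`, making `w` shorter than `w t`. -/
theorem reflectionCocycle_eq_one_of_length_lt {w t : W} (ht : cs.IsReflection t)
    (h : cs.length (w * t) < cs.length w) : reflectionCocycle cs w t = 1 := by
  by_contra h1
  have h0 : reflectionCocycle cs w t = 0 := by
    generalize reflectionCocycle cs w t = x at h1
    revert x; decide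
  have h2 : reflectionCocycle cs (w * t) t = 1 := by
    rw [reflectionCocycle_mul, reflectionCocycle_self cs ht, mul_inv_cancel_right, h0, add_zero]
  obtain ⟨ω, hω, hw⟩ := cs.exists_isReduced (w * t)
  have h3 : t ∈ cs.rightInvSeq ω := by
    refine mem_rightInvSeq_of_reflectionCocycle_ne_zero cs ?_
    rw [← hw, h2]; exact one_ne_zero
  have h4 := (cs.isRightInversion_of_mem_rightInvSeq hω h3).2
  rw [← hw, mul_assoc, ht.mul_self, mul_one] at h4
  exact h.not_gt h4

/-- Strong exchange. The word need not be reduced, which matters for the palindromic words of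
elements of `J̃`. -/
theorem mem_rightInvSeq_of_length_lt {ω : List B} {t : W} (ht : cs.IsReflection t)
    (h : cs.length (cs.wordProd ω * t) < cs.length (cs.wordProd ω)) : t ∈ cs.rightInvSeq ω := by
  refine mem_rightInvSeq_of_reflectionCocycle_ne_zero cs ?_
  rw [reflectionCocycle_eq_one_of_length_lt cs ht h]
  exact one_ne_zero

end ReflectionCocycle
-- Retractions, inversions and centralizers for a split set of generators.
-- For `n = 2k + 1` the element `(a b)^k` conjugates `a` to `b`.
theorem isConj_of_mul_pow_odd {G : Type*} [Group G] {a b : G} (ha : a * a = 1) (hb : b * b = 1)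
    {n : ℕ} (hn : Odd n) (h : (a * b) ^ n = 1) : IsConj a b := by
  obtain ⟨k, rfl⟩ := hn
  have hbi : b⁻¹ = b := inv_eq_of_mul_eq_one_left hb
  have h1 := mul_pow_mul_mul_pow ha hb k
  rw [isConj_iff]
  refine ⟨(a * b) ^ k, ?_⟩
  rw [pow_succ, two_mul, pow_add] at h
  generalize (a * b) ^ k = x at *
  rw [mul_inv_eq_iff_eq_mul]
  calc x * a = x⁻¹ * (x * x * (a * b)) * b⁻¹ := by group
    _ = x⁻¹ * b := by rw [h, mul_one, hbi]
    _ = b * x := by nth_rw 1 [← h1]; group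

/-- The set of simple reflections is the union of `I` and `J`, and no element of `I` is conjugate
to an element of `J`. -/
structure IsConjSplit {B W : Type*} [Group W] {M : CoxeterMatrix B} (cs : CoxeterSystem M W)
    (I J : Set W) : Prop where
  union_eq : I ∪ J = Set.range cs.simple
  not_isConj : ∀ s ∈ I, ∀ t ∈ J, ¬ IsConj s t

namespace IsConjSplit

variable {B W : Type*} [Group W] {M : CoxeterMatrix B} {cs : CoxeterSystem M W} {I J : Set W}

theorem symm (h : IsConjSplit cs I J) : IsConjSplit cs J I :=
  ⟨Set.union_comm I J ▸ h.union_eq, fun s hs t ht hst => h.not_isConj t ht s hs hst.symm⟩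

theorem exists_simple_left (h : IsConjSplit cs I J) {s : W} (hs : s ∈ I) :
    ∃ i, cs.simple i = s :=
  h.union_eq.subset (.inl hs)

theorem exists_simple_right (h : IsConjSplit cs I J) {s : W} (hs : s ∈ J) :
    ∃ i, cs.simple i = s :=
  h.union_eq.subset (.inr hs)

theorem notMem_right (h : IsConjSplit cs I J) {s : W} (hs : s ∈ I) : s ∉ J :=
  fun hs' => h.not_isConj s hs s hs' (IsConj.refl s)

theorem simple_mem_left_or_right (h : IsConjSplit cs I J) (i : B) :
    cs.simple i ∈ I ∨ cs.simple i ∈ J :=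
  h.union_eq.symm.subset ⟨i, rfl⟩

theorem mul_self_left (h : IsConjSplit cs I J) {s : W} (hs : s ∈ I) : s * s = 1 := by
  obtain ⟨i, rfl⟩ := h.exists_simple_left hs
  exact cs.simple_mul_simple_self i

theorem inv_left (h : IsConjSplit cs I J) {s : W} (hs : s ∈ I) : s⁻¹ = s :=
  inv_eq_of_mul_eq_one_left (h.mul_self_left hs)

theorem even_of_mul_pow_eq_one (h : IsConjSplit cs I J) {s t : W} (hs : s ∈ I) (ht : t ∈ J)
    {n : ℕ} (hn : (s * t) ^ n = 1) : Even n := by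
  by_contra h1
  exact h.not_isConj s hs t ht <| isConj_of_mul_pow_odd (h.mul_self_left hs)
    (h.symm.mul_self_left ht) (Nat.not_even_iff_odd.1 h1) hn

-- Only mixed pairs need an argument: their exponent is even, so the surviving involution is raised
-- to an even power.
open Classical in
theorem isLiftable_retraction (h : IsConjSplit cs I J) :
    M.IsLiftable fun i => if cs.simple i ∈ I then cs.simple i else 1 := by
  intro i j
  have hp := cs.simple_mul_simple_pow i j
  dsimp only
  split_ifs with hi hj hj
  · exact hp
  · obtain ⟨k, hk⟩ := h.even_of_mul_pow_eq_one hi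
      ((h.simple_mem_left_or_right j).resolve_left hj) hp
    rw [mul_one, hk, ← two_mul, pow_mul, cs.simple_sq, one_pow]
  · obtain ⟨k, hk⟩ :=
      h.symm.even_of_mul_pow_eq_one ((h.simple_mem_left_or_right i).resolve_left hi) hj hp
    rw [one_mul, hk, ← two_mul, pow_mul, cs.simple_sq, one_pow]
  · rw [mul_one, one_pow]

/-- The endomorphism of `W` that fixes `I` and kills `J`. -/
noncomputable def retraction (h : IsConjSplit cs I J) : W →* W :=
  cs.lift ⟨_, h.isLiftable_retraction⟩

open Classical in
theorem retraction_simple (h : IsConjSplit cs I J) (i : B) :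
    h.retraction (cs.simple i) = if cs.simple i ∈ I then cs.simple i else 1 :=
  cs.lift_apply_simple _ i

theorem retraction_of_mem_right (h : IsConjSplit cs I J) {s : W} (hs : s ∈ J) :
    h.retraction s = 1 := by
  obtain ⟨i, rfl⟩ := h.exists_simple_right hs
  rw [retraction_simple, if_neg fun hi => h.notMem_right hi hs]

theorem retraction_of_mem_closure (h : IsConjSplit cs I J) {w : W}
    (hw : w ∈ Subgroup.closure I) : h.retraction w = w := by
  have h1 : Set.EqOn h.retraction (MonoidHom.id W) I := fun s hs => by
    obtain ⟨i, rfl⟩ := h.exists_simple_left hs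
    rw [retraction_simple, if_pos hs, MonoidHom.id_apply]
  exact MonoidHom.eqOn_closure h1 hw

theorem retraction_of_mem_WTilde (h : IsConjSplit cs I J) {w : W} (hw : w ∈ WTilde I J) :
    h.retraction w = 1 := by
  have h1 : WTilde I J ≤ h.retraction.ker := by
    rw [WTilde, Subgroup.closure_le]
    rintro _ ⟨s, hs, w, -, rfl⟩
    simp [MonoidHom.mem_ker, h.retraction_of_mem_right hs]
  exact h1 hw

theorem eq_one_of_mem (h : IsConjSplit cs I J) {w : W} (hw : w ∈ Subgroup.closure I)
    (hw' : w ∈ WTilde I J) : w = 1 := by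
  rw [← h.retraction_of_mem_closure hw, h.retraction_of_mem_WTilde hw']

theorem simple_mem_left (h : IsConjSplit cs I J) {i : B}
    (hi : cs.simple i ∈ Subgroup.closure I) : cs.simple i ∈ I :=
  simple_mem_of_mem_closure cs (h.union_eq ▸ Set.subset_union_left) hi

theorem notMem_closure (h : IsConjSplit cs I J) {s : W} (hs : s ∈ J) :
    s ∉ Subgroup.closure I := fun hs' => by
  obtain ⟨i, rfl⟩ := h.exists_simple_right hs
  exact h.notMem_right (h.simple_mem_left hs') hs

theorem retraction_symm_of_mem_closure (h : IsConjSplit cs I J) {w : W}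
    (hw : w ∈ Subgroup.closure I) : h.symm.retraction w = 1 := by
  have h1 : Subgroup.closure I ≤ h.symm.retraction.ker := by
    rw [Subgroup.closure_le]
    exact fun s hs => h.symm.retraction_of_mem_right hs
  exact h1 hw

/-- The opposite retraction kills `W_I` and fixes `J`, so it recovers `s` from `x s x⁻¹`. This makes
`ν` well defined. -/
theorem eq_of_conj_eq_conj (h : IsConjSplit cs I J) {s t x y : W} (hs : s ∈ J) (ht : t ∈ J)
    (hx : x ∈ Subgroup.closure I) (hy : y ∈ Subgroup.closure I)
    (hst : x * s * x⁻¹ = y * t * y⁻¹) : s = t := by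
  have := congrArg h.symm.retraction hst
  simpa [h.retraction_symm_of_mem_closure hx, h.retraction_symm_of_mem_closure hy,
    h.symm.retraction_of_mem_closure (Subgroup.subset_closure hs),
    h.symm.retraction_of_mem_closure (Subgroup.subset_closure ht)] using this

theorem nu_eq (h : IsConjSplit cs I J) {r : JTilde I J} {s w : W} (hs : s ∈ J)
    (hw : w ∈ Subgroup.closure I) (hr : (r : W) = w * s * w⁻¹) : nu r = s := by
  obtain ⟨hn, x, hx, hrx⟩ := nu_spec r
  exact h.eq_of_conj_eq_conj hn hs hx hw (hrx ▸ hr)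

open Classical in
theorem retraction_wordProd (h : IsConjSplit cs I J) (ω : List B) :
    h.retraction (cs.wordProd ω) = cs.wordProd (ω.filter fun i => cs.simple i ∈ I) := by
  induction ω with
  | nil => simp
  | cons i ω ih =>
    rw [cs.wordProd_cons, map_mul, ih, retraction_simple, List.filter_cons]
    by_cases hi : cs.simple i ∈ I <;> simp [hi, cs.wordProd_cons]

/-- The retraction deletes the letters outside `I` without changing the element; a reduced word
admits no such shortening. -/
theorem simple_mem_of_isReduced (h : IsConjSplit cs I J) {ω : List B} (hω : cs.IsReduced ω)
    (hw : cs.wordProd ω ∈ Subgroup.closure I) : ∀ i ∈ ω, cs.simple i ∈ I := by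
  classical
  have h1 := h.retraction_wordProd ω
  rw [h.retraction_of_mem_closure hw] at h1
  have h2 := cs.length_wordProd_le (ω.filter fun i => cs.simple i ∈ I)
  rw [← h1, hω.eq] at h2
  have h3 := List.filter_sublist.eq_of_length_le h2
  rw [List.filter_eq_self] at h3
  simpa using h3

theorem mem_closure_of_mem_rightInvSeq {ω : List B} (hω : ∀ i ∈ ω, cs.simple i ∈ I) {t : W}
    (ht : t ∈ cs.rightInvSeq ω) : t ∈ Subgroup.closure I := by
  induction ω with
  | nil => simp at ht
  | cons i ω ih =>
    rw [List.forall_mem_cons] at hω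
    rw [CoxeterSystem.rightInvSeq, List.mem_cons] at ht
    rcases ht with rfl | ht
    · have h1 : cs.wordProd ω ∈ Subgroup.closure I := by
        refine list_prod_mem fun x hx => ?_
        obtain ⟨j, hj, rfl⟩ := List.mem_map.1 hx
        exact Subgroup.subset_closure (hω.2 j hj)
      exact mul_mem (mul_mem (inv_mem h1) (Subgroup.subset_closure hω.1)) h1
    · exact ih hω.2 ht

theorem mem_closure_of_reflectionCocycle_eq_one (h : IsConjSplit cs I J) {w t : W}
    (hw : w ∈ Subgroup.closure I) (ht : reflectionCocycle cs w t = 1) :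
    t ∈ Subgroup.closure I := by
  obtain ⟨ω, hω, rfl⟩ := cs.exists_isReduced w
  refine mem_closure_of_mem_rightInvSeq (h.simple_mem_of_isReduced hω hw)
    (mem_rightInvSeq_of_reflectionCocycle_ne_zero cs ?_)
  rw [ht]; exact one_ne_zero

/-- The centralizer in `W_I` of an element `s` of `J` is generated by `I ∩ s^⊥`. -/
theorem mem_closure_perp (h : IsConjSplit cs I J) {s w : W} (hs : s ∈ J)
    (hw : w ∈ Subgroup.closure I) (hc : w * s = s * w) :
    w ∈ Subgroup.closure (I ∩ perp cs s) := by
  classical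
  induction hn : cs.length w using Nat.strong_induction_on generalizing w with
  | _ n ih =>
  rcases eq_or_ne w 1 with rfl | hw1
  · exact one_mem _
  obtain ⟨i, hi⟩ := cs.exists_rightDescent_of_ne_one hw1
  have h1 := reflectionCocycle_eq_one_of_length_lt cs (cs.isReflection_simple i) hi
  have hiI := h.simple_mem_left (h.mem_closure_of_reflectionCocycle_eq_one hw h1)
  have hic := Subgroup.subset_closure hiI
  obtain ⟨j, rfl⟩ := h.exists_simple_right hs
  -- The cocycle of `w s = s w` at the descent `s_i` is computed in both ways. The outcome is that
  -- `s s_i s` is an inversion of `w`, hence lies in `W_I`; the retraction then forces `s s_i s =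
  -- s_i`, and the induction continues with `w s_i`.
  have h2 : reflectionCocycle cs (w * cs.simple j) (cs.simple i) = 1 := by
    rw [hc, reflectionCocycle_mul, h1, reflectionCocycle_simple, if_neg, add_zero]
    intro h3
    exact h.notMem_closure hs (h3 ▸ mul_mem (mul_mem hw hic) (inv_mem hw))
  rw [reflectionCocycle_mul, reflectionCocycle_simple, if_neg, zero_add] at h2
  · have h3 := h.retraction_of_mem_closure (h.mem_closure_of_reflectionCocycle_eq_one hw h2)
    rw [map_mul, map_mul, map_inv, h.retraction_of_mem_right hs, one_mul, inv_one, mul_one,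
      h.retraction_of_mem_closure hic, eq_mul_inv_iff_mul_eq] at h3
    have h4 : w * cs.simple i ∈ Subgroup.closure (I ∩ perp cs (cs.simple j)) := by
      refine ih _ (hn ▸ hi) (mul_mem hw hic) ?_ rfl
      rw [mul_assoc, h3, ← mul_assoc, hc, mul_assoc]
    have h5 : cs.simple i ∈ Subgroup.closure (I ∩ perp cs (cs.simple j)) :=
      Subgroup.subset_closure ⟨hiI, ⟨i, rfl⟩, h3.symm⟩
    have := mul_mem h4 h5
    rwa [cs.simple_mul_simple_cancel_right] at this
  · intro h3
    exact h.notMem_right hiI (h3 ▸ hs)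

/-! ### Canonical generators of `W̃`. -/

theorem isReflection_of_mem_JTilde (h : IsConjSplit cs I J) {r : W} (hr : r ∈ JTilde I J) :
    cs.IsReflection r := by
  obtain ⟨s, hs, w, -, rfl⟩ := hr
  obtain ⟨i, rfl⟩ := h.exists_simple_right hs
  exact ⟨w, i, rfl⟩

/-- The last letter `s ∈ J` of a reduced word contributes the right inversion `u⁻¹ s u`, where `u ∈
W_I` is the product of the letters after it. Without such a letter the element lies in `W_I ∩ W̃ =
1`. -/
theorem exists_mem_JTilde_length_lt (h : IsConjSplit cs I J) {w : W} (hw : w ∈ WTilde I J)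
    (hw1 : w ≠ 1) : ∃ r ∈ JTilde I J, cs.length (w * r) < cs.length w := by
  have key : ∀ ω : List B, cs.wordProd ω ∈ Subgroup.closure I ∨
      ∃ r ∈ JTilde I J, r ∈ cs.rightInvSeq ω := by
    intro ω
    induction ω with
    | nil => exact .inl (by simp)
    | cons i ω ih =>
      rw [cs.wordProd_cons, CoxeterSystem.rightInvSeq]
      rcases ih with h1 | ⟨r, hr, hr'⟩
      · rcases h.simple_mem_left_or_right i with hi | hi
        · exact .inl (mul_mem (Subgroup.subset_closure hi) h1)
        · exact .inr ⟨_, ⟨_, hi, _, inv_mem h1, by rw [inv_inv]⟩, List.mem_cons_self⟩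
      · exact .inr ⟨r, hr, List.mem_cons_of_mem _ hr'⟩
  obtain ⟨ω, hω, rfl⟩ := cs.exists_isReduced w
  rcases key ω with h1 | ⟨r, hr, hr'⟩
  · exact absurd (h.eq_one_of_mem h1 hw) hw1
  · exact ⟨r, hr, (cs.isRightInversion_of_mem_rightInvSeq hω hr').2⟩

theorem mem_rightInvSeq_append {ω ω' : List B} {t : W} :
    t ∈ cs.rightInvSeq (ω ++ ω') ↔
      cs.wordProd ω' * t * (cs.wordProd ω')⁻¹ ∈ cs.rightInvSeq ω ∨ t ∈ cs.rightInvSeq ω' := by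
  induction ω with
  | nil => simp
  | cons i ω ih =>
    rw [List.cons_append, CoxeterSystem.rightInvSeq, CoxeterSystem.rightInvSeq, List.mem_cons,
      List.mem_cons, ih, or_assoc, cs.wordProd_append]
    refine or_congr_left ?_
    rw [mul_inv_eq_iff_eq_mul, ← eq_inv_mul_iff_mul_eq]
    simp only [mul_inv_rev, mul_assoc]

theorem eq_of_mem_inversionSet (h : IsConjSplit cs I J) {r t : W} (hr : r ∈ JTilde I J)
    (ht : t ∈ inversionSet cs r) (ht' : t ∈ WTilde I J) : t = r := by
  have hrW : r ∈ WTilde I J := Subgroup.subset_closure hr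
  obtain ⟨s, hs, w, hw, rfl⟩ := hr
  obtain ⟨j, rfl⟩ := h.exists_simple_right hs
  obtain ⟨ω, hω, rfl⟩ := cs.exists_isReduced w
  have hI := h.simple_mem_of_isReduced hω hw
  have e : cs.wordProd ω * cs.simple j * (cs.wordProd ω)⁻¹ =
      cs.wordProd (ω ++ ([j] ++ ω.reverse)) := by
    simp [cs.wordProd_append, cs.wordProd_cons, mul_assoc]
  have ht2 := ht.2
  rw [e] at ht2
  have h1 := mem_rightInvSeq_of_length_lt cs ht.1 ht2
  rw [mem_rightInvSeq_append, mem_rightInvSeq_append] at h1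
  have ht1 : t ≠ 1 := by
    rintro rfl
    exact lt_irrefl _ (mul_one (cs.wordProd _) ▸ ht2)
  -- The three cases are the segments of the word `w · s · w⁻¹`. In the outer ones a conjugate of
  -- `t`, or `t` itself, lies in `W_I` and has trivial retraction, so `t = 1`; the middle letter
  -- yields `w s w⁻¹`.
  rcases h1 with h1 | h1 | h1
  · have h2 := mem_closure_of_mem_rightInvSeq hI h1
    have h3 : ∀ x ∈ Subgroup.closure I, h.retraction x = 1 → x = 1 := fun x hx hx1 => by
      rw [← h.retraction_of_mem_closure hx, hx1]
    have h4 := h3 _ h2 (by simp [h.retraction_of_mem_WTilde ht'])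
    exact absurd (conj_eq_one_iff.1 h4) ht1
  · rw [CoxeterSystem.rightInvSeq_singleton, List.mem_singleton, cs.wordProd_reverse,
      inv_inv] at h1
    rw [← h1]; group
  · have h2 := mem_closure_of_mem_rightInvSeq (fun i hi => hI i (List.mem_reverse.1 hi)) h1
    exact absurd (h.eq_one_of_mem h2 ht') ht1

theorem JTilde_eq_canonicalGenerators (h : IsConjSplit cs I J) :
    JTilde I J = canonicalGenerators cs (WTilde I J) := by
  ext t
  constructor
  · intro ht
    have h1 := h.isReflection_of_mem_JTilde ht
    refine ⟨h1, Set.Subset.antisymm (fun x hx => h.eq_of_mem_inversionSet ht hx.1 hx.2) ?_⟩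
    rintro _ rfl
    refine ⟨⟨h1, ?_⟩, Subgroup.subset_closure ht⟩
    rw [h1.mul_self, cs.length_one]
    exact h1.odd_length.pos
  · rintro ⟨h1, h2⟩
    have h3 : t ∈ inversionSet cs t ∩ (WTilde I J : Set W) := h2 ▸ rfl
    have ht1 : t ≠ 1 := by
      rintro rfl
      exact absurd h1.odd_length (by simp)
    obtain ⟨r, hr, hlt⟩ := h.exists_mem_JTilde_length_lt h3.2 ht1
    have h4 : r ∈ inversionSet cs t ∩ (WTilde I J : Set W) :=
      ⟨⟨h.isReflection_of_mem_JTilde hr, hlt⟩, Subgroup.subset_closure hr⟩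
    rw [h2] at h4
    exact h4 ▸ hr

end IsConjSplit
-- Double coset representatives and the matrix `M̃`.
section

variable {B W : Type*} [Group W] {M : CoxeterMatrix B} {cs : CoxeterSystem M W} {I J : Set W}

theorem commute_of_mem_closure_perp {s w : W} (hw : w ∈ Subgroup.closure (I ∩ perp cs s)) :
    w * s = s * w := by
  have h1 : Subgroup.closure (I ∩ perp cs s) ≤ Subgroup.centralizer {s} := by
    rw [Subgroup.closure_le]
    rintro x ⟨-, -, hx⟩
    exact Subgroup.mem_centralizer_singleton_iff.2 hx.symm
  exact Subgroup.mem_centralizer_singleton_iff.1 (h1 hw)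

theorem conj_eq_of_mem_closure_perp {s w : W} (hw : w ∈ Subgroup.closure (I ∩ perp cs s)) :
    w * s * w⁻¹ = s := by
  rw [commute_of_mem_closure_perp hw, mul_inv_cancel_right]

theorem IsDoubleCosetRep.symm {r r' : JTilde I J} {g : W} (hg : IsDoubleCosetRep cs r r' g) :
    IsDoubleCosetRep cs r' r g⁻¹ := by
  obtain ⟨⟨h1, h2⟩, x, hx, y, hy, hr, hr', a, ha, b, hb, hxy⟩ := hg
  refine ⟨⟨inv_mem h1, fun c hc d hd => ?_⟩, y, hy, x, hx, hr', hr, b⁻¹, inv_mem hb, a⁻¹,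
    inv_mem ha, ?_⟩
  · rw [cs.length_inv, ← cs.length_inv (c * g⁻¹ * d)]
    convert h2 d⁻¹ (inv_mem hd) c⁻¹ (inv_mem hc) using 2
    group
  · rw [← inv_inj, mul_inv_rev, inv_inv, hxy]; group

/-- The factors `a` and `b` centralize `ν(r)` and `ν(r')`, so only `g` matters up to conjugation. -/
theorem IsDoubleCosetRep.exists_mul_eq_conj {r r' : JTilde I J} {g : W}
    (hg : IsDoubleCosetRep cs r r' g) :
    ∃ z, (r * r' : W) = z * (nu r * (g * nu r' * g⁻¹)) * z⁻¹ := by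
  obtain ⟨-, x, hx, y, hy, hr, hr', a, ha, b, hb, hxy⟩ := hg
  refine ⟨x * a, ?_⟩
  have hy : y = x * (a * g * b) := by rw [← hxy]; group
  have h1 := conj_eq_of_mem_closure_perp ha
  have h2 := conj_eq_of_mem_closure_perp hb
  calc (r * r' : W) = x * nu r * x⁻¹ * (y * nu r' * y⁻¹) := by rw [← hr, ← hr']
    _ = x * (a * nu r * a⁻¹) * x⁻¹ * (x * (a * g) * (b * nu r' * b⁻¹) * (x * (a * g))⁻¹) := by
      rw [h1, hy]; group
    _ = _ := by rw [h2]; group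

theorem IsDoubleCosetRep.orderOf_eq {r r' : JTilde I J} {g : W}
    (hg : IsDoubleCosetRep cs r r' g) :
    orderOf (r * r' : W) = orderOf (nu r * (g * nu r' * g⁻¹)) := by
  obtain ⟨z, hz⟩ := hg.exists_mul_eq_conj
  rw [hz]
  exact MulEquiv.orderOf_eq (MulAut.conj z) _

theorem IsDoubleCosetRep.simple_notMem_left {r r' : JTilde I J} {i : B}
    (hg : IsDoubleCosetRep cs r r' (cs.simple i)) : cs.simple i ∉ I ∩ perp cs (nu r) := by
  intro hi
  have h1 := hg.1.2 _ (inv_mem (Subgroup.subset_closure hi)) 1 (one_mem _)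
  rw [inv_mul_cancel, mul_one, cs.length_one, cs.length_simple] at h1
  exact absurd h1 (by norm_num)

theorem IsDoubleCosetRep.simple_notMem_right {r r' : JTilde I J} {i : B}
    (hg : IsDoubleCosetRep cs r r' (cs.simple i)) : cs.simple i ∉ I ∩ perp cs (nu r') := by
  have := hg.symm
  rw [cs.inv_simple] at this
  exact this.simple_notMem_left

/-- The conjugation action of `W_I` on `J̃`. -/
def JTilde.conj (w : Subgroup.closure I) (r : JTilde I J) : JTilde I J :=
  ⟨w * r * (w : W)⁻¹, by
    obtain ⟨_, s, hs, x, hx, rfl⟩ := r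
    exact ⟨s, hs, w * x, mul_mem w.2 hx, by group⟩⟩

theorem JTilde.coe_conj (w : Subgroup.closure I) (r : JTilde I J) :
    (JTilde.conj w r : W) = w * r * (w : W)⁻¹ := rfl

theorem JTilde.conj_one (r : JTilde I J) : JTilde.conj 1 r = r :=
  Subtype.ext (by simp [JTilde.coe_conj])

theorem JTilde.conj_mul (w w' : Subgroup.closure I) (r : JTilde I J) :
    JTilde.conj (w * w') r = JTilde.conj w (JTilde.conj w' r) :=
  Subtype.ext (by simp [JTilde.coe_conj, mul_assoc])

theorem JTilde.conj_injective (w : Subgroup.closure I) :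
    Function.Injective (JTilde.conj (J := J) w) := fun r r' h => by
  rw [← JTilde.conj_one r, ← JTilde.conj_one r', ← inv_mul_cancel w, JTilde.conj_mul, h,
    JTilde.conj_mul]

/-- An element of `J`, as an element of `J̃`. -/
def JTilde.of {s : W} (hs : s ∈ J) : JTilde I J :=
  ⟨s, s, hs, 1, one_mem _, by simp⟩

end

namespace IsConjSplit

variable {B W : Type*} [Group W] {M : CoxeterMatrix B} {cs : CoxeterSystem M W} {I J : Set W}

theorem nu_of (h : IsConjSplit cs I J) {s : W} (hs : s ∈ J) : nu (JTilde.of (I := I) hs) = s :=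
  h.nu_eq hs (one_mem _) (by simp [JTilde.of])

theorem nu_conj (h : IsConjSplit cs I J) (w : Subgroup.closure I) (r : JTilde I J) :
    nu (JTilde.conj w r) = nu r := by
  obtain ⟨hn, x, hx, hr⟩ := nu_spec r
  refine h.nu_eq hn (mul_mem w.2 hx) ?_
  rw [JTilde.coe_conj, hr]; simp only [mul_assoc, mul_inv_rev]

theorem mul_self_JTilde (h : IsConjSplit cs I J) (r : JTilde I J) : (r * r : W) = 1 :=
  (h.isReflection_of_mem_JTilde r.2).mul_self

theorem isDoubleCosetRep_conj (h : IsConjSplit cs I J) (w : Subgroup.closure I)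
    {r r' : JTilde I J} {g : W} (hg : IsDoubleCosetRep cs r r' g) :
    IsDoubleCosetRep cs (JTilde.conj w r) (JTilde.conj w r') g := by
  obtain ⟨h1, x, hx, y, hy, hr, hr', a, ha, b, hb, hxy⟩ := hg
  unfold IsDoubleCosetRep
  rw [h.nu_conj, h.nu_conj]
  refine ⟨h1, w * x, mul_mem w.2 hx, w * y, mul_mem w.2 hy, ?_, ?_, a, ha, b, hb, ?_⟩
  · rw [JTilde.coe_conj]; nth_rw 1 [hr]; group
  · rw [JTilde.coe_conj]; nth_rw 1 [hr']; group
  · rw [← hxy]; group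

/-- Two choices of `x` differ by an element of `W_I` centralizing `ν(r)`, which lies in `W_{I ∩
s^⊥}` by `mem_closure_perp`; likewise for `y`. So the double coset is independent of the choices. -/
theorem isDoubleCosetRep_mul (h : IsConjSplit cs I J) {r r' : JTilde I J} {g g' : W}
    (hg : IsDoubleCosetRep cs r r' g) (hg' : IsDoubleCosetRep cs r r' g') :
    ∃ a ∈ Subgroup.closure (I ∩ perp cs (nu r)), ∃ b ∈ Subgroup.closure (I ∩ perp cs (nu r')),
      g' = a * g * b := by
  obtain ⟨-, x, hx, y, hy, hr, hr', a, ha, b, hb, hxy⟩ := hg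
  obtain ⟨-, x', hx', y', hy', h1, h1', a', ha', b', hb', hxy'⟩ := hg'
  have key : ∀ (r : JTilde I J), ∀ x ∈ Subgroup.closure I, ∀ y ∈ Subgroup.closure I,
      (r : W) = x * nu r * x⁻¹ → (r : W) = y * nu r * y⁻¹ →
      x⁻¹ * y ∈ Subgroup.closure (I ∩ perp cs (nu r)) := by
    intro r x hx y hy hr hr'
    refine h.mem_closure_perp (nu_spec r).1 (mul_mem (inv_mem hx) hy) ?_
    have : x * nu r * x⁻¹ = y * nu r * y⁻¹ := hr ▸ hr'
    rw [eq_mul_inv_iff_mul_eq] at this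
    rw [mul_assoc, ← this]; group
  refine ⟨a'⁻¹ * (x'⁻¹ * x) * a, mul_mem (mul_mem (inv_mem ha') (key r _ hx' _ hx h1 hr)) ha,
    b * (y⁻¹ * y') * b'⁻¹, mul_mem (mul_mem hb (key r' _ hy _ hy' hr' h1')) (inv_mem hb'), ?_⟩
  calc g' = a'⁻¹ * (a' * g' * b') * b'⁻¹ := by group
    _ = a'⁻¹ * (x'⁻¹ * x) * (x⁻¹ * y) * (y⁻¹ * y') * b'⁻¹ := by rw [← hxy']; group
    _ = _ := by rw [hxy]; group

theorem length_le_of_isDoubleCosetRep (h : IsConjSplit cs I J) {r r' : JTilde I J} {g g' : W}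
    (hg : IsDoubleCosetRep cs r r' g) (hg' : IsDoubleCosetRep cs r r' g') :
    cs.length g ≤ cs.length g' := by
  obtain ⟨a, ha, b, hb, rfl⟩ := h.isDoubleCosetRep_mul hg hg'
  exact hg.1.2 a ha b hb

theorem isDoubleCosetRep_eq_one (h : IsConjSplit cs I J) {r r' : JTilde I J} {g : W}
    (h1 : IsDoubleCosetRep cs r r' 1) (hg : IsDoubleCosetRep cs r r' g) : g = 1 := by
  have := h.length_le_of_isDoubleCosetRep hg h1
  rwa [cs.length_one, Nat.le_zero, cs.length_eq_zero_iff] at this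

/-- Uniqueness of minimal representatives is needed only in lengths `0` and `1`. In length `1`, `g`
is a simple reflection in the parabolic subgroup generated by `u` and the two sets `I ∩ s^⊥`, `I ∩
t^⊥`; minimality excludes the latter. -/
theorem isDoubleCosetRep_eq_of_mem (h : IsConjSplit cs I J) {r r' : JTilde I J} {u g : W}
    (hu : u ∈ I) (h1 : IsDoubleCosetRep cs r r' u) (hg : IsDoubleCosetRep cs r r' g) :
    g = u := by
  have h2 := (h.length_le_of_isDoubleCosetRep hg h1).antisymm
    (h.length_le_of_isDoubleCosetRep h1 hg)
  obtain ⟨j, hj⟩ := h.exists_simple_left hu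
  rw [← hj, cs.length_simple, cs.length_eq_one_iff] at h2
  obtain ⟨i, rfl⟩ := h2
  obtain ⟨a, ha, b, hb, hab⟩ := h.isDoubleCosetRep_mul h1 hg
  set K := (I ∩ perp cs (nu r)) ∪ (I ∩ perp cs (nu r')) ∪ {u} with hK
  have hKS : K ⊆ Set.range cs.simple := by
    rintro x ((hx | hx) | rfl)
    exacts [hx.2.1, hx.2.1, ⟨j, hj⟩]
  have h3 : cs.simple i ∈ Subgroup.closure K := by
    rw [hab]
    refine mul_mem (mul_mem (Subgroup.closure_mono ?_ ha) (Subgroup.subset_closure (.inr rfl)))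
      (Subgroup.closure_mono ?_ hb)
    · exact fun x hx => .inl (.inl hx)
    · exact fun x hx => .inl (.inr hx)
  rcases simple_mem_of_mem_closure cs hKS h3 with (h4 | h4) | h4
  · exact absurd h4 hg.simple_notMem_left
  · exact absurd h4 hg.simple_notMem_right
  · exact h4

theorem mTilde_of_mem (h : IsConjSplit cs I J) {r r' : JTilde I J} {u : W} (hne : r ≠ r')
    (hnu : nu r = nu r') (hu : u ∈ I) (hg : IsDoubleCosetRep cs r r' u) :
    mTilde cs r r' = orderOf (nu r * u) / 2 := by
  have h1 := h.isDoubleCosetRep_eq_of_mem hu hg (doubleCosetRep_spec cs r r')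
  rw [mTilde, if_neg hne, if_pos hnu, h1, if_pos hu]

theorem mTilde_of_notMem (h : IsConjSplit cs I J) {r r' : JTilde I J} {g : W} (hne : r ≠ r')
    (hnu : nu r = nu r') (hgI : g ∉ I) (hg : IsDoubleCosetRep cs r r' g) :
    mTilde cs r r' = 0 := by
  rw [mTilde, if_neg hne, if_pos hnu, if_neg]
  intro h1
  rw [h.isDoubleCosetRep_eq_of_mem h1 (doubleCosetRep_spec cs r r') hg] at hgI
  exact hgI h1

theorem mTilde_of_one (h : IsConjSplit cs I J) {r r' : JTilde I J}
    (hnu : nu r ≠ nu r') (hg : IsDoubleCosetRep cs r r' 1) :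
    mTilde cs r r' = orderOf (nu r * nu r') := by
  rw [mTilde, if_neg (ne_of_apply_ne nu hnu), if_neg hnu, if_pos]
  exact h.isDoubleCosetRep_eq_one hg (doubleCosetRep_spec cs r r')

theorem mTilde_of_ne_one (h : IsConjSplit cs I J) {r r' : JTilde I J} {g : W}
    (hnu : nu r ≠ nu r') (hg1 : g ≠ 1) (hg : IsDoubleCosetRep cs r r' g) :
    mTilde cs r r' = 0 := by
  rw [mTilde, if_neg (ne_of_apply_ne nu hnu), if_neg hnu, if_neg]
  intro h1
  exact hg1 (h.isDoubleCosetRep_eq_one (h1 ▸ doubleCosetRep_spec cs r r') hg)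

/-- The value of the matrix, in terms of any double coset representative. -/
theorem mTilde_eq [DecidableEq W] [DecidablePred (· ∈ I)] (h : IsConjSplit cs I J)
    {r r' : JTilde I J} {g : W} (hg : IsDoubleCosetRep cs r r' g) :
    mTilde cs r r' = if r = r' then 1
      else if nu r = nu r' then if g ∈ I then orderOf (nu r * g) / 2 else 0
      else if g = 1 then orderOf (nu r * nu r') else 0 := by
  split_ifs with h1 h2 h3 h3
  · rw [mTilde, if_pos h1]
  · exact h.mTilde_of_mem h1 h2 h3 hg
  · exact h.mTilde_of_notMem h1 h2 h3 hg
  · exact h.mTilde_of_one h2 (h3 ▸ hg)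
  · exact h.mTilde_of_ne_one h2 h3 hg

theorem mTilde_conj (h : IsConjSplit cs I J) (w : Subgroup.closure I) (r r' : JTilde I J) :
    mTilde cs (JTilde.conj w r) (JTilde.conj w r') = mTilde cs r r' := by
  classical
  have hg := doubleCosetRep_spec cs r r'
  rw [h.mTilde_eq hg, h.mTilde_eq (h.isDoubleCosetRep_conj w hg), h.nu_conj, h.nu_conj]
  simp only [(JTilde.conj_injective w).eq_iff]

theorem mTilde_symm (h : IsConjSplit cs I J) (r r' : JTilde I J) :
    mTilde cs r' r = mTilde cs r r' := by
  classical
  have hg := doubleCosetRep_spec cs r r'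
  generalize doubleCosetRep cs r r' = g at hg
  rw [h.mTilde_eq hg]
  split_ifs with h1 h2 h3 h3
  · rw [mTilde, if_pos h1.symm]
  · have h4 := hg.symm
    rw [h.inv_left h3] at h4
    rw [h.mTilde_of_mem (Ne.symm h1) h2.symm h3 h4, h2]
  · refine h.mTilde_of_notMem (Ne.symm h1) h2.symm (fun h4 => h3 ?_) hg.symm
    have := h.inv_left h4
    rw [inv_inv] at this
    exact this ▸ h4
  · have h4 := hg.symm
    rw [h3, inv_one] at h4
    rw [h.mTilde_of_one (Ne.symm h2) h4, ← MulEquiv.orderOf_eq (MulAut.conj (nu r)) _,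
      MulAut.conj_apply, ← mul_assoc, mul_inv_cancel_right]
  · exact h.mTilde_of_ne_one (Ne.symm h2) (inv_ne_one.2 h3) hg.symm

theorem even_orderOf (h : IsConjSplit cs I J) {s u : W} (hs : s ∈ J) (hu : u ∈ I) :
    Even (orderOf (s * u)) :=
  h.symm.even_of_mul_pow_eq_one hs hu (pow_orderOf_eq_one _)

theorem mTilde_ne_one (h : IsConjSplit cs I J) {r r' : JTilde I J} (hne : r ≠ r') :
    mTilde cs r r' ≠ 1 := by
  classical
  have hg := doubleCosetRep_spec cs r r'
  generalize doubleCosetRep cs r r' = g at hg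
  have hs := (nu_spec r).1
  rw [h.mTilde_eq hg, if_neg hne]
  split_ifs with h2 h3 h3
  · intro h4
    -- Evenness excludes order `3`, the other value whose half rounds down to `1`.
    have h5 : orderOf (nu r * g) = 2 := by
      obtain ⟨k, hk⟩ := h.even_orderOf hs h3
      omega
    obtain ⟨i, rfl⟩ := h.exists_simple_left h3
    refine hg.simple_notMem_left ⟨h3, ⟨i, rfl⟩, ?_⟩
    have h6 := pow_orderOf_eq_one (nu r * cs.simple i)
    rw [h5, pow_two, mul_eq_one_iff_eq_inv, mul_inv_rev, cs.inv_simple,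
      h.symm.inv_left hs] at h6
    exact h6
  · exact zero_ne_one
  · rw [Ne, orderOf_eq_one_iff, mul_eq_one_iff_eq_inv, h.symm.inv_left (nu_spec r').1]
    exact h2
  · exact zero_ne_one

/-- Used for `s · (u s u) = (s u)²`, the origin of the halved entries; `0 / 2 = 0` covers infinite
order. -/
theorem orderOf_sq (h : IsConjSplit cs I J) {s u : W} (hs : s ∈ J) (hu : u ∈ I) :
    orderOf ((s * u) ^ 2) = orderOf (s * u) / 2 := by
  rw [orderOf_pow' _ two_ne_zero, Nat.gcd_eq_right (h.even_orderOf hs hu).two_dvd]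

theorem orderOf_mul_eq_or (h : IsConjSplit cs I J) (r r' : JTilde I J) :
    orderOf (r * r' : W) = mTilde cs r r' ∨ mTilde cs r r' = 0 := by
  classical
  have hg := doubleCosetRep_spec cs r r'
  generalize doubleCosetRep cs r r' = g at hg
  rw [h.mTilde_eq hg]
  split_ifs with h1 h2 h3 h3
  · rw [h1, h.mul_self_JTilde, orderOf_one]; exact .inl rfl
  · left
    rw [hg.orderOf_eq, ← h.orderOf_sq (nu_spec r).1 h3, ← h2, h.inv_left h3, pow_two]
    simp only [mul_assoc]
  · exact .inr rfl
  · left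
    rw [hg.orderOf_eq, h3, one_mul, inv_one, mul_one]
  · exact .inr rfl

theorem isDoubleCosetRep_of_one (h : IsConjSplit cs I J) {s t : W} (hs : s ∈ J) (ht : t ∈ J) :
    IsDoubleCosetRep cs (JTilde.of (I := I) hs) (JTilde.of ht) 1 := by
  unfold IsDoubleCosetRep
  rw [h.nu_of, h.nu_of]
  refine ⟨⟨one_mem _, fun a _ b _ => by simp⟩, 1, one_mem _, 1, one_mem _, by simp [JTilde.of],
    by simp [JTilde.of], 1, one_mem _, 1, one_mem _, by simp⟩

theorem mTilde_of_of_dvd (h : IsConjSplit cs I J) {s t : W} (hs : s ∈ J) (ht : t ∈ J) :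
    mTilde cs (JTilde.of (I := I) hs) (JTilde.of ht) ∣ orderOf (s * t) := by
  by_cases hst : s = t
  · subst hst
    rw [mTilde, if_pos rfl]
    exact one_dvd _
  · have h1 : nu (JTilde.of (I := I) hs) ≠ nu (JTilde.of (I := I) ht) := by
      rwa [h.nu_of, h.nu_of]
    rw [h.mTilde_of_one h1 (h.isDoubleCosetRep_of_one hs ht), h.nu_of, h.nu_of]

theorem isDoubleCosetRep_of_conj (h : IsConjSplit cs I J) {s : W} (hs : s ∈ J)
    (u : Subgroup.closure I) (hu : (u : W) ∈ I) (hsu : s * u ≠ u * s) :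
    IsDoubleCosetRep cs (JTilde.of hs) (JTilde.conj u (JTilde.of hs)) u := by
  unfold IsDoubleCosetRep
  rw [h.nu_conj, h.nu_of]
  refine ⟨⟨u.2, fun a ha b hb => ?_⟩, 1, one_mem _, u, u.2, by simp [JTilde.of],
    by simp [JTilde.of, JTilde.coe_conj], 1, one_mem _, 1, one_mem _, by simp⟩
  obtain ⟨i, hi⟩ := h.exists_simple_left hu
  rw [← hi, cs.length_simple, Nat.one_le_iff_ne_zero, Ne, cs.length_eq_zero_iff, hi]
  intro h1
  have h2 : (u : W) = a⁻¹ * b⁻¹ := by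
    rw [mul_assoc, mul_eq_one_iff_inv_eq, ← mul_inv_eq_iff_eq_mul] at h1
    exact h1.symm
  rw [h2] at hsu
  exact hsu (commute_of_mem_closure_perp (mul_mem (inv_mem ha) (inv_mem hb))).symm

/-- Only divisibility holds in general: if `u` commutes with `s`, both indices coincide and the
entry is `1`. -/
theorem mTilde_conj_dvd (h : IsConjSplit cs I J) {s : W} (hs : s ∈ J)
    (u : Subgroup.closure I) (hu : (u : W) ∈ I) :
    mTilde cs (JTilde.of hs) (JTilde.conj u (JTilde.of hs)) ∣ orderOf (s * u) / 2 := by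
  by_cases hsu : s * u = u * s
  · rw [mTilde, if_pos]
    · exact one_dvd _
    · exact Subtype.ext (by simp [JTilde.of, JTilde.coe_conj, ← hsu])
  · have h1 : JTilde.of hs ≠ JTilde.conj u (JTilde.of hs) := fun e => hsu <| by
      have := congrArg Subtype.val e
      rw [JTilde.coe_conj, eq_mul_inv_iff_mul_eq] at this
      exact this
    rw [h.mTilde_of_mem h1 (h.nu_conj u _).symm hu (h.isDoubleCosetRep_of_conj hs u hu hsu),
      h.nu_of]

end IsConjSplit

/-! ### The semidirect product and the Coxeter system on `W̃`. -/

namespace IsConjSplit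

variable {B W : Type*} [Group W] {M : CoxeterMatrix B} {cs : CoxeterSystem M W} {I J : Set W}

/-- `M̃` as a Coxeter matrix. -/
noncomputable def tildeMatrix (h : IsConjSplit cs I J) : CoxeterMatrix (JTilde I J) where
  M := Matrix.of fun r r' => mTilde cs r r'
  isSymm := Matrix.IsSymm.ext fun r r' => h.mTilde_symm r r'
  diagonal r := by rw [Matrix.of_apply, mTilde, if_pos rfl]
  off_diagonal r r' hne := h.mTilde_ne_one hne

theorem tildeMatrix_apply (h : IsConjSplit cs I J) (r r' : JTilde I J) :
    h.tildeMatrix r r' = mTilde cs r r' := rfl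

theorem isLiftable_coe (h : IsConjSplit cs I J) : h.tildeMatrix.IsLiftable
    fun r => (⟨r, Subgroup.subset_closure r.2⟩ : WTilde I J) := by
  intro r r'
  rw [tildeMatrix_apply]
  refine Subtype.ext ?_
  rcases h.orderOf_mul_eq_or r r' with h1 | h1
  · rw [← h1]
    exact pow_orderOf_eq_one _
  · rw [h1, pow_zero]

/-- The homomorphism from the Coxeter group of `M̃` to `W̃`. -/
noncomputable def toWTilde (h : IsConjSplit cs I J) : h.tildeMatrix.Group →* WTilde I J :=
  h.tildeMatrix.toCoxeterSystem.lift ⟨_, h.isLiftable_coe⟩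

theorem toWTilde_simple (h : IsConjSplit cs I J) (r : JTilde I J) :
    h.toWTilde (h.tildeMatrix.simple r) = ⟨r, Subgroup.subset_closure r.2⟩ :=
  h.tildeMatrix.toCoxeterSystem.lift_apply_simple h.isLiftable_coe r

theorem toWTilde_surjective (h : IsConjSplit cs I J) : Function.Surjective h.toWTilde := by
  have h1 : WTilde I J ≤ h.toWTilde.range.map (WTilde I J).subtype := by
    refine (Subgroup.closure_le _).2 fun r hr => ?_
    exact ⟨_, ⟨_, h.toWTilde_simple ⟨r, hr⟩⟩, rfl⟩
  intro w
  obtain ⟨x, ⟨y, rfl⟩, hx⟩ := h1 w.2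
  exact ⟨y, Subtype.ext hx⟩

theorem isLiftable_conj (h : IsConjSplit cs I J) (w : Subgroup.closure I) :
    h.tildeMatrix.IsLiftable fun r => h.tildeMatrix.simple (JTilde.conj w r) := by
  intro r r'
  rw [tildeMatrix_apply, ← h.mTilde_conj w]
  exact h.tildeMatrix.toCoxeterSystem.simple_mul_simple_pow _ _

/-- The endomorphism of the Coxeter group of `M̃` induced by conjugation by `w ∈ W_I`. -/
noncomputable def conjHom (h : IsConjSplit cs I J) (w : Subgroup.closure I) :
    h.tildeMatrix.Group →* h.tildeMatrix.Group :=
  h.tildeMatrix.toCoxeterSystem.lift ⟨_, h.isLiftable_conj w⟩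

theorem conjHom_simple (h : IsConjSplit cs I J) (w : Subgroup.closure I) (r : JTilde I J) :
    h.conjHom w (h.tildeMatrix.simple r) = h.tildeMatrix.simple (JTilde.conj w r) :=
  h.tildeMatrix.toCoxeterSystem.lift_apply_simple (h.isLiftable_conj w) r

theorem tildeGroup_hom_ext (h : IsConjSplit cs I J) {G : Type*} [MulOneClass G]
    {φ ψ : h.tildeMatrix.Group →* G}
    (hφ : ∀ r, φ (h.tildeMatrix.simple r) = ψ (h.tildeMatrix.simple r)) : φ = ψ :=
  h.tildeMatrix.toCoxeterSystem.ext_simple hφ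

theorem conjHom_one (h : IsConjSplit cs I J) : h.conjHom 1 = MonoidHom.id _ :=
  h.tildeGroup_hom_ext fun r => by
    rw [conjHom_simple, JTilde.conj_one, MonoidHom.id_apply]

theorem conjHom_mul (h : IsConjSplit cs I J) (w w' : Subgroup.closure I) :
    h.conjHom (w * w') = (h.conjHom w).comp (h.conjHom w') :=
  h.tildeGroup_hom_ext fun r => by
    rw [MonoidHom.comp_apply, conjHom_simple, conjHom_simple, conjHom_simple, JTilde.conj_mul]

/-- The action of `W_I` on the Coxeter group of `M̃`. -/
noncomputable def conjAut (h : IsConjSplit cs I J) :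
    Subgroup.closure I →* MulAut h.tildeMatrix.Group where
  toFun w := MonoidHom.toMulEquiv (h.conjHom w) (h.conjHom w⁻¹)
    (by rw [← conjHom_mul, inv_mul_cancel, conjHom_one])
    (by rw [← conjHom_mul, mul_inv_cancel, conjHom_one])
  map_one' := MulEquiv.ext fun x => DFunLike.congr_fun h.conjHom_one x
  map_mul' w w' := MulEquiv.ext fun x => DFunLike.congr_fun (h.conjHom_mul w w') x

theorem conjAut_simple (h : IsConjSplit cs I J) (w : Subgroup.closure I) (r : JTilde I J) :
    h.conjAut w (h.tildeMatrix.simple r) = h.tildeMatrix.simple (JTilde.conj w r) :=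
  h.conjHom_simple w r

open Classical in
/-- The images of the simple reflections in the semidirect product of `W_I` and the Coxeter group
of `M̃`. -/
noncomputable def semidirectSimple (h : IsConjSplit cs I J) (i : B) :
    h.tildeMatrix.Group ⋊[h.conjAut] Subgroup.closure I :=
  if hi : cs.simple i ∈ I then SemidirectProduct.inr ⟨cs.simple i, Subgroup.subset_closure hi⟩
  else SemidirectProduct.inl (h.tildeMatrix.simple
    (JTilde.of ((h.simple_mem_left_or_right i).resolve_left hi)))

theorem semidirectSimple_of_mem_left (h : IsConjSplit cs I J) {i : B} (hi : cs.simple i ∈ I) :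
    h.semidirectSimple i =
      SemidirectProduct.inr ⟨cs.simple i, Subgroup.subset_closure hi⟩ :=
  dif_pos hi

theorem semidirectSimple_of_mem_right (h : IsConjSplit cs I J) {i : B} (hi : cs.simple i ∈ J) :
    h.semidirectSimple i = SemidirectProduct.inl (h.tildeMatrix.simple (JTilde.of hi)) :=
  dif_neg fun hi' => h.notMem_right hi' hi

theorem tildeMatrix_simple_mul_pow (h : IsConjSplit cs I J) {r r' : JTilde I J} {n : ℕ}
    (hn : mTilde cs r r' ∣ n) :
    (h.tildeMatrix.simple r * h.tildeMatrix.simple r') ^ n = 1 := by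
  obtain ⟨k, rfl⟩ := hn
  rw [pow_mul]
  have := h.tildeMatrix.toCoxeterSystem.simple_mul_simple_pow r r'
  rw [CoxeterMatrix.toCoxeterSystem_simple] at this
  rw [← h.tildeMatrix_apply, this, one_pow]

theorem semidirectSimple_mul_pow (h : IsConjSplit cs I J) {i j : B} (hi : cs.simple i ∈ J)
    (hj : cs.simple j ∈ I) {n : ℕ} (hn : (cs.simple i * cs.simple j) ^ n = 1) :
    (h.semidirectSimple i * h.semidirectSimple j) ^ n = 1 := by
  obtain ⟨k, rfl⟩ := (h.symm.even_of_mul_pow_eq_one hi hj hn).two_dvd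
  set u : Subgroup.closure I := ⟨cs.simple j, Subgroup.subset_closure hj⟩ with hu
  have huu : u⁻¹ = u := Subtype.ext (cs.inv_simple j)
  -- The square falls into the normal factor, where the relations of `M̃` apply.
  have h1 : (h.semidirectSimple i * h.semidirectSimple j) ^ 2 =
      SemidirectProduct.inl (h.tildeMatrix.simple (JTilde.of hi) *
        h.tildeMatrix.simple (JTilde.conj u (JTilde.of hi))) := by
    rw [h.semidirectSimple_of_mem_right hi, h.semidirectSimple_of_mem_left hj, ← hu, map_mul,
      ← conjAut_simple, SemidirectProduct.inl_aut, huu, pow_two]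
    simp only [mul_assoc]
  rw [pow_mul, h1, ← map_pow, h.tildeMatrix_simple_mul_pow, map_one]
  refine (h.mTilde_conj_dvd hi u hj).trans ?_
  have h2 := orderOf_dvd_of_pow_eq_one hn
  obtain ⟨m, hm⟩ := (h.even_orderOf hi hj).two_dvd
  change orderOf (cs.simple i * cs.simple j) / 2 ∣ k
  rw [hm] at h2 ⊢
  rw [Nat.mul_div_cancel_left _ two_pos]
  exact Nat.dvd_of_mul_dvd_mul_left two_pos h2

theorem isLiftable_semidirectSimple (h : IsConjSplit cs I J) :
    M.IsLiftable h.semidirectSimple := by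
  intro i j
  have hp := cs.simple_mul_simple_pow i j
  rcases h.simple_mem_left_or_right i with hi | hi <;>
    rcases h.simple_mem_left_or_right j with hj | hj
  · rw [h.semidirectSimple_of_mem_left hi, h.semidirectSimple_of_mem_left hj, ← map_mul, ← map_pow]
    exact (congrArg _ (Subtype.ext hp)).trans (map_one SemidirectProduct.inr)
  · have h1 := h.semidirectSimple_mul_pow hj hi (cs.simple_mul_simple_pow' i j)
    have h2 : h.semidirectSimple i * h.semidirectSimple j = h.semidirectSimple i *
        (h.semidirectSimple j * h.semidirectSimple i) * (h.semidirectSimple i)⁻¹ := by group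
    rw [h2, conj_pow, h1, mul_one, mul_inv_cancel]
  · exact h.semidirectSimple_mul_pow hi hj hp
  · rw [h.semidirectSimple_of_mem_right hi, h.semidirectSimple_of_mem_right hj, ← map_mul,
      ← map_pow, h.tildeMatrix_simple_mul_pow, map_one]
    exact (h.mTilde_of_of_dvd hi hj).trans (orderOf_dvd_of_pow_eq_one hp)

/-- The homomorphism from `W` to the semidirect product of `W_I` and the Coxeter group of `M̃`. -/
noncomputable def toSemidirect (h : IsConjSplit cs I J) :
    W →* h.tildeMatrix.Group ⋊[h.conjAut] Subgroup.closure I :=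
  cs.lift ⟨_, h.isLiftable_semidirectSimple⟩

theorem toSemidirect_simple (h : IsConjSplit cs I J) (i : B) :
    h.toSemidirect (cs.simple i) = h.semidirectSimple i :=
  cs.lift_apply_simple h.isLiftable_semidirectSimple i

theorem toSemidirect_coe (h : IsConjSplit cs I J) (w : Subgroup.closure I) :
    h.toSemidirect w = SemidirectProduct.inr w := by
  obtain ⟨w, hw⟩ := w
  induction hw using Subgroup.closure_induction with
  | mem s hs =>
    obtain ⟨i, rfl⟩ := h.exists_simple_left hs
    rw [toSemidirect_simple, h.semidirectSimple_of_mem_left hs]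
  | one => rw [map_one]; exact (map_one _).symm
  | mul x y hx hy ihx ihy =>
    rw [map_mul, ihx, ihy, ← map_mul]; rfl
  | inv x hx ih => rw [map_inv, ih, ← map_inv]; rfl

theorem toSemidirect_JTilde (h : IsConjSplit cs I J) (r : JTilde I J) :
    h.toSemidirect r = SemidirectProduct.inl (h.tildeMatrix.simple r) := by
  obtain ⟨r, s, hs, w, hw, rfl⟩ := r
  have h1 := h.toSemidirect_coe ⟨w, hw⟩
  have h2 := SemidirectProduct.inl_aut (φ := h.conjAut) ⟨w, hw⟩
    (h.tildeMatrix.simple (JTilde.of hs))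
  rw [conjAut_simple] at h2
  have h3 : h.toSemidirect s = SemidirectProduct.inl (h.tildeMatrix.simple (JTilde.of hs)) := by
    obtain ⟨i, rfl⟩ := h.exists_simple_right hs
    rw [toSemidirect_simple, h.semidirectSimple_of_mem_right hs]
  rw [map_inv, ← h1, ← h3, ← map_inv, ← map_mul, ← map_mul] at h2
  exact h2.symm

/-- Followed by `toSemidirect`, the map agrees on generators with the injective
`SemidirectProduct.inl`. -/
theorem toWTilde_injective (h : IsConjSplit cs I J) : Function.Injective h.toWTilde := by
  have h1 : (h.toSemidirect.comp (WTilde I J).subtype).comp h.toWTilde =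
      SemidirectProduct.inl := h.tildeGroup_hom_ext fun r => by
    rw [MonoidHom.comp_apply, toWTilde_simple]
    exact h.toSemidirect_JTilde r
  refine Function.Injective.of_comp (f := h.toSemidirect.comp (WTilde I J).subtype) ?_
  rw [← MonoidHom.coe_comp, h1]
  exact SemidirectProduct.inl_injective

/-- `(W̃, J̃)` as a Coxeter system with matrix `M̃`. -/
noncomputable def tildeSystem (h : IsConjSplit cs I J) :
    CoxeterSystem h.tildeMatrix (WTilde I J) :=
  ⟨(MulEquiv.ofBijective h.toWTilde ⟨h.toWTilde_injective, h.toWTilde_surjective⟩).symm⟩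

theorem tildeSystem_simple (h : IsConjSplit cs I J) (r : JTilde I J) :
    (h.tildeSystem.simple r : W) = r :=
  congrArg Subtype.val (h.toWTilde_simple r)

/-- A relation-free pair could a priori still have finite order; the geometric representation of the
system just constructed on `W̃` rules this out. -/
theorem orderOf_mul_eq (h : IsConjSplit cs I J) (r r' : JTilde I J) :
    orderOf (r * r' : W) = mTilde cs r r' := by
  refine (h.orderOf_mul_eq_or r r').elim id fun h0 => ?_
  have h1 := orderOf_simple_mul_simple_eq_zero h.tildeSystem (h.tildeMatrix_apply r r' ▸ h0)
  rw [← Subgroup.orderOf_coe, Subgroup.coe_mul, tildeSystem_simple, tildeSystem_simple] at h1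
  rw [h0, h1]

end IsConjSplit
end CoxeterSemidirect

theorem mainTheorem3 {B W : Type*} [Group W] {M : CoxeterMatrix B} (cs : CoxeterSystem M W)
    (I J : Set W) (hIJ : I ∪ J = Set.range cs.simple)
    (hconj : ∀ s ∈ I, ∀ t ∈ J, ¬ IsConj s t) :
    (∃ (M' : CoxeterMatrix (CoxeterSemidirect.JTilde I J))
        (cs' : CoxeterSystem M' (CoxeterSemidirect.WTilde I J)),
      (∀ r : CoxeterSemidirect.JTilde I J, (cs'.simple r : W) = (r : W)) ∧
      (∀ r r' : CoxeterSemidirect.JTilde I J, M' r r' = CoxeterSemidirect.mTilde cs r r')) ∧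
    (∀ r r' : CoxeterSemidirect.JTilde I J,
      orderOf ((r : W) * (r' : W)) = CoxeterSemidirect.mTilde cs r r') ∧
    CoxeterSemidirect.JTilde I J =
      CoxeterSemidirect.canonicalGenerators cs (CoxeterSemidirect.WTilde I J) := by
  have h : CoxeterSemidirect.IsConjSplit cs I J := ⟨hIJ, hconj⟩
  exact ⟨⟨h.tildeMatrix, h.tildeSystem, h.tildeSystem_simple, h.tildeMatrix_apply⟩,
    h.orderOf_mul_eq, h.JTilde_eq_canonicalGenerators⟩
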